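/- Let $d\ge 2$, let $\Omega\subset\mathbb R^d$ be a bounded open set with $C^1$ boundary and outer unit normal $\nu$, let $T>0$, $J\in\mathbb N$, $J\ge1$, $\Delta t=T/J$. Let $N\ge 1$, $0=\alpha_0<\alpha_1<\dots<\alpha_N$ be real numbers, $s=\alpha_N+2$, $s^*=s/(s-1)$, and $$W(\mathrm{div};\Omega)=\{\mathbf v\in (L^s(\Omega))^d:\ \nabla\cdot\mathbf v\in L^2(\Omega)\}$$ with the divergence in the sense of distributions. For $j=1,\dots,J$ let the following be given. * Coefficients $a_i^j\in L^\infty(\Omega)$, $i=0,\dots,N$, with $0\le a_i^j\le\overline a$ for all $i$ and $\underline a<a_0^j,a_N^j<\overline a$ a.e. in $\Omega$, where $0<\underline a<\overline a<\infty$ are constants; put $F^j(x,z)=\sum_{i=0}^N a_i^j(x)z^{\alpha_i}$ for $z\ge 0$. * A measurable porosity $\phi$, independent of $j$, with $0<\underline\phi\le\phi\le\overline\phi<\infty$ a.e. in $\Omega$. * Source terms $f^j\in L^2(\Omega)$, and an initial density $\rho_0\in L^2(\Omega)$. * Boundary data $\rho_b^j$ in the space of traces on $\partial\Omega$ of the functions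 $\psi\in L^2(\Omega)$ with $\nabla\psi\in(L^{s^*}(\Omega))^d$; two such functions have the same trace if their difference lies in the closure of $C_c^\infty(\Omega)$ in the norm $\|\psi\|_{L^2}+\|\nabla\psi\|_{L^{s^*}}$. For $\mathbf v\in W(\mathrm{div};\Omega)$ the pairing of $\rho_b^j$ with the normal trace of $\mathbf v$ is given by Green's formula, $$\langle\rho_b^j,\mathbf v\cdot\nu\rangle=\int_\Omega\psi\,\nabla\cdot\mathbf v\,dx+\int_\Omega\nabla\psi\cdot\mathbf v\,dx,$$ for any such $\psi$ with trace $\rho_b^j$; it does not depend on the choice of $\psi$. Then for every $j\in\{1,\dots,J\}$ and every $\rho^{j-1}\in L^2(\Omega)$ there is exactly one pair $(\mathbf m^j,\rho^j)\in W(\mathrm{div};\Omega)\times L^2(\Omega)$ such that $$\int_\Omega F^j(x,|\mathbf m^j|)\,\mathbf m^j\cdot\mathbf v\,dx-\int_\Omega\rho^j\,\nabla\cdot\mathbf v\,dx=-\langle\rho_b^j,\mathbf v\cdot\nu\rangle\qquad\text{for all }\mathbf v\in W(\mathrm{div};\Omega),$$ $$\int_\Omega\frac{\phi\rho^j}{\Delta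 t}\,q\,dx+\int_\Omega(\nabla\cdot\mathbf m^j)\,q\,dx=\int_\Omega f^jq\,dx+\int_\Omega\frac{\phi\rho^{j-1}}{\Delta t}\,q\,dx\qquad\text{for all }q\in L^2(\Omega).$$ Consequently, there is exactly one family $(\mathbf m^j,\rho^j)_{1\le j\le J}$ in $W(\mathrm{div};\Omega)\times L^2(\Omega)$ that, with $\rho^0=\rho_0$, satisfies these equations for all $j=1,\dots,J$. -/

import Mathlib

open MeasureTheory
open scoped ENNReal ContDiff

noncomputable section

namespace Forchheimer

/-- The exponents `0 = α₀ < α₁ < ⋯ < α_N`, `N ≥ 1`, of the generalized polynomial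
`F(x, z) = ∑ i, a_i(x) z ^ α_i`. -/
structure Exponents where
  N : ℕ
  one_le_N : 1 ≤ N
  α : Fin (N + 1) → ℝ
  α_zero : α 0 = 0
  strictMono : StrictMono α

namespace Exponents

variable (e : Exponents)

/-- `s = α_N + 2`. -/
def s : ℝ := e.α (Fin.last e.N) + 2

/-- The conjugate exponent `s* = s / (s - 1)`. -/
def sStar : ℝ := e.s / (e.s - 1)

/-- `s`, as an exponent of a Lebesgue space. -/
def p : ℝ≥0∞ := ENNReal.ofReal e.s

/-- `s*`, as an exponent of a Lebesgue space. -/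
def q : ℝ≥0∞ := ENNReal.ofReal e.sStar

theorem two_lt_s : 2 < e.s := by
  have h : e.α 0 < e.α (Fin.last e.N) := e.strictMono (by
    have := e.one_le_N
    simp [Fin.lt_def]; omega)
  rw [e.α_zero] at h
  unfold s; linarith

theorem holderConjugate_real : e.s.HolderConjugate e.sStar :=
  Real.HolderConjugate.conjExponent (by linarith [e.two_lt_s])

instance : ENNReal.HolderConjugate e.p e.q := e.holderConjugate_real.ennrealOfReal

instance : ENNReal.HolderConjugate e.q e.p := ENNReal.HolderConjugate.symm

instance : Fact (1 ≤ e.p) := ⟨ENNReal.HolderConjugate.one_le e.p e.q⟩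

instance : Fact (1 ≤ e.q) := ⟨ENNReal.HolderConjugate.one_le e.q e.p⟩

end Exponents

/-- `ℝᵈ` with its Euclidean norm. -/
abbrev Space (d : ℕ) : Type := EuclideanSpace ℝ (Fin d)

/-- The space `Lʳ(Ω)` of scalar functions. -/
abbrev LScalar {d : ℕ} (Ω : Set (Space d)) (r : ℝ≥0∞) : Type :=
  Lp ℝ r (volume.restrict Ω)

/-- The space `(Lʳ(Ω))ᵈ` of vector fields. -/
abbrev LVector {d : ℕ} (Ω : Set (Space d)) (r : ℝ≥0∞) : Type :=
  Lp (Space d) r (volume.restrict Ω)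

/-- `φ ∈ C_c^∞(Ω)`. -/
structure IsTest {d : ℕ} (Ω : Set (Space d)) (φ : Space d → ℝ) : Prop where
  smooth : ContDiff ℝ ∞ φ
  compact : HasCompactSupport φ
  supp : tsupport φ ⊆ Ω

/-- `w` is the weak divergence of `v` on `Ω`. -/
def HasWeakDiv {d : ℕ} (Ω : Set (Space d)) (v : Space d → Space d) (w : Space d → ℝ) : Prop :=
  ∀ φ, IsTest Ω φ → ∫ x in Ω, inner ℝ (v x) (gradient φ x) = -∫ x in Ω, w x * φ x

/-- `g` is the weak gradient of `ψ` on `Ω`. -/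
def HasWeakGrad {d : ℕ} (Ω : Set (Space d)) (ψ : Space d → ℝ) (g : Space d → Space d) : Prop :=
  ∀ φ, IsTest Ω φ → ∫ x in Ω, ψ x • gradient φ x = -∫ x in Ω, φ x • g x

section helpers

variable {d : ℕ} {Ω : Set (Space d)} {φ : Space d → ℝ}

theorem IsTest.memLp (h : IsTest Ω φ) (r : ℝ≥0∞) : MemLp φ r (volume.restrict Ω) :=
  (h.smooth.continuous.memLp_of_hasCompactSupport h.compact).restrict Ω

theorem IsTest.memLp_gradient (h : IsTest Ω φ) (r : ℝ≥0∞) :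
    MemLp (gradient φ) r (volume.restrict Ω) := by
  have hc : Continuous (gradient φ) :=
    (InnerProductSpace.toDual ℝ (Space d)).symm.continuous.comp
      (h.smooth.continuous_fderiv (by simp))
  have hs : HasCompactSupport (gradient φ) :=
    (h.compact.fderiv ℝ).comp_left
      (g := (InnerProductSpace.toDual ℝ (Space d)).symm) (map_zero _)
  exact (hc.memLp_of_hasCompactSupport hs).restrict Ω

theorem integrable_mul_of_Lp {r t : ℝ≥0∞} [ENNReal.HolderConjugate r t] {u w : Space d → ℝ}
    (hu : MemLp u r (volume.restrict Ω)) (hw : MemLp w t (volume.restrict Ω)) :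
    Integrable (fun x => u x * w x) (volume.restrict Ω) :=
  hu.integrable_mul hw

theorem integrable_inner_of_Lp {r t : ℝ≥0∞} [ENNReal.HolderConjugate r t]
    {u w : Space d → Space d}
    (hu : MemLp u r (volume.restrict Ω)) (hw : MemLp w t (volume.restrict Ω)) :
    Integrable (fun x => inner ℝ (u x) (w x)) (volume.restrict Ω) :=
  memLp_one_iff_integrable.1
    (MemLp.of_bilin (r := 1) (fun a b => inner ℝ a b) 1 hu hw
      (hu.1.inner hw.1) (.of_forall fun x => by
        rw [one_mul]; exact norm_inner_le_norm (u x) (w x)))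

theorem integrable_smul_of_Lp {r t : ℝ≥0∞} [ENNReal.HolderConjugate r t]
    {u : Space d → ℝ} {w : Space d → Space d}
    (hu : MemLp u r (volume.restrict Ω)) (hw : MemLp w t (volume.restrict Ω)) :
    Integrable (fun x => u x • w x) (volume.restrict Ω) :=
  memLp_one_iff_integrable.1 (hw.smul hu)

end helpers

/-- `W(div; Ω) = {v ∈ (Lˢ(Ω))ᵈ : div v ∈ L²(Ω)}`, realized as a subspace of
`(Lˢ(Ω))ᵈ × L²(Ω)`: its elements are the pairs `(v, div v)`, in which the first component
determines the second one (`Wdiv_ext`). -/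
def Wdiv {d : ℕ} (Ω : Set (Space d)) (e : Exponents) :
    Submodule ℝ (LVector Ω e.p × LScalar Ω 2) where
  carrier := {z | HasWeakDiv Ω z.1 z.2}
  zero_mem' := by
    intro φ _
    have h1 : ∫ x in Ω, inner ℝ ((0 : LVector Ω e.p) x) (gradient φ x) = 0 := by
      refine integral_eq_zero_of_ae ?_
      filter_upwards [Lp.coeFn_zero (Space d) e.p (volume.restrict Ω)] with x hx
      rw [hx]; simp
    have h2 : ∫ x in Ω, (0 : LScalar Ω 2) x * φ x = 0 := by
      refine integral_eq_zero_of_ae ?_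
      filter_upwards [Lp.coeFn_zero ℝ 2 (volume.restrict Ω)] with x hx
      rw [hx]; simp
    simp only [Prod.fst_zero, Prod.snd_zero]
    rw [h1, h2, neg_zero]
  add_mem' := by
    intro y z hy hz φ hφ
    have h1 : ∫ x in Ω, inner ℝ ((y.1 + z.1 : LVector Ω e.p) x) (gradient φ x)
        = (∫ x in Ω, inner ℝ (y.1 x) (gradient φ x))
          + ∫ x in Ω, inner ℝ (z.1 x) (gradient φ x) := by
      rw [← integral_add
        (integrable_inner_of_Lp (Lp.memLp y.1) (hφ.memLp_gradient e.q))
        (integrable_inner_of_Lp (Lp.memLp z.1) (hφ.memLp_gradient e.q))]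
      refine integral_congr_ae ?_
      filter_upwards [Lp.coeFn_add y.1 z.1] with x hx
      rw [hx, Pi.add_apply, inner_add_left]
    have h2 : ∫ x in Ω, (y.2 + z.2 : LScalar Ω 2) x * φ x
        = (∫ x in Ω, y.2 x * φ x) + ∫ x in Ω, z.2 x * φ x := by
      rw [← integral_add
        (integrable_mul_of_Lp (Lp.memLp y.2) (hφ.memLp 2))
        (integrable_mul_of_Lp (Lp.memLp z.2) (hφ.memLp 2))]
      refine integral_congr_ae ?_
      filter_upwards [Lp.coeFn_add y.2 z.2] with x hx
      rw [hx, Pi.add_apply, add_mul]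
    have hy' := hy φ hφ
    have hz' := hz φ hφ
    simp only [Prod.fst_add, Prod.snd_add]
    rw [h1, h2, hy', hz']; ring
  smul_mem' := by
    intro c z hz φ hφ
    have h1 : ∫ x in Ω, inner ℝ ((c • z.1 : LVector Ω e.p) x) (gradient φ x)
        = c * ∫ x in Ω, inner ℝ (z.1 x) (gradient φ x) := by
      rw [← integral_const_mul]
      refine integral_congr_ae ?_
      filter_upwards [Lp.coeFn_smul c z.1] with x hx
      rw [hx, Pi.smul_apply, real_inner_smul_left]
    have h2 : ∫ x in Ω, (c • z.2 : LScalar Ω 2) x * φ x = c * ∫ x in Ω, z.2 x * φ x := by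
      rw [← integral_const_mul]
      refine integral_congr_ae ?_
      filter_upwards [Lp.coeFn_smul c z.2] with x hx
      rw [hx, Pi.smul_apply, smul_eq_mul, mul_assoc]
    have hz' := hz φ hφ
    simp only [Prod.smul_fst, Prod.smul_snd]
    rw [h1, h2, hz']; ring

/-- The vector field `v` underlying an element of `W(div; Ω)`. -/
def fieldOf {d : ℕ} {Ω : Set (Space d)} {e : Exponents} (v : Wdiv Ω e) : LVector Ω e.p :=
  v.1.1

/-- The divergence `div v ∈ L²(Ω)` of `v ∈ W(div; Ω)`. -/
def divOf {d : ℕ} {Ω : Set (Space d)} {e : Exponents} (v : Wdiv Ω e) : LScalar Ω 2 :=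
  v.1.2

/-- On an open set, an element of `W(div; Ω)` is determined by its vector field. -/
theorem Wdiv_ext {d : ℕ} {Ω : Set (Space d)} (hΩ : IsOpen Ω) {e : Exponents}
    {v w : Wdiv Ω e} (h : fieldOf v = fieldOf w) : v = w := by
  refine Subtype.ext (Prod.ext h (Lp.ext ?_))
  have hm : MemLp (fun x => v.1.2 x - w.1.2 x) 2 (volume.restrict Ω) :=
    (Lp.memLp v.1.2).sub (Lp.memLp w.1.2)
  have hloc : LocallyIntegrableOn (fun x => v.1.2 x - w.1.2 x) Ω volume :=
    locallyIntegrableOn_of_locallyIntegrable_restrict (hm.locallyIntegrable (by norm_num))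
  have hz := hΩ.ae_eq_zero_of_integral_contDiff_smul_eq_zero hloc (fun g h1 h2 h3 => by
    have hg : IsTest Ω g := ⟨h1, h2, h3⟩
    have hv := v.2 g hg
    have hw := w.2 g hg
    have hvw : v.1.1 = w.1.1 := h
    rw [hvw] at hv
    have hs : ∫ x in Ω, g x • (v.1.2 x - w.1.2 x)
        = (∫ x in Ω, v.1.2 x * g x) - ∫ x in Ω, w.1.2 x * g x := by
      rw [← integral_sub (integrable_mul_of_Lp (Lp.memLp v.1.2) (hg.memLp 2))
        (integrable_mul_of_Lp (Lp.memLp w.1.2) (hg.memLp 2))]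
      refine integral_congr_ae (.of_forall fun x => ?_)
      simp; ring
    rw [← setIntegral_eq_integral_of_forall_compl_eq_zero (s := Ω), hs]
    · linarith
    · intro x hx
      rw [image_eq_zero_of_notMem_tsupport (fun hc => hx (h3 hc)), zero_smul])
  refine (ae_restrict_iff' hΩ.measurableSet).2 ?_
  filter_upwards [hz] with x hx hxΩ
  exact sub_eq_zero.1 (hx hxΩ)

/-- The space `{ψ ∈ L²(Ω) : ∇ψ ∈ (L^{s*}(Ω))ᵈ}`, realized as the space of pairs `(ψ, ∇ψ)`. -/
def GradSpace {d : ℕ} (Ω : Set (Space d)) (e : Exponents) :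
    Submodule ℝ (LScalar Ω 2 × LVector Ω e.q) where
  carrier := {z | HasWeakGrad Ω z.1 z.2}
  zero_mem' := by
    intro φ _
    have h1 : ∫ x in Ω, φ x • (0 : LVector Ω e.q) x = 0 := by
      refine integral_eq_zero_of_ae ?_
      filter_upwards [Lp.coeFn_zero (Space d) e.q (volume.restrict Ω)] with x hx
      rw [hx]; simp
    have h2 : ∫ x in Ω, (0 : LScalar Ω 2) x • gradient φ x = 0 := by
      refine integral_eq_zero_of_ae ?_
      filter_upwards [Lp.coeFn_zero ℝ 2 (volume.restrict Ω)] with x hx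
      rw [hx]; simp
    simp only [Prod.fst_zero, Prod.snd_zero]
    rw [h1, h2, neg_zero]
  add_mem' := by
    intro y z hy hz φ hφ
    have h1 : ∫ x in Ω, (y.1 + z.1 : LScalar Ω 2) x • gradient φ x
        = (∫ x in Ω, y.1 x • gradient φ x) + ∫ x in Ω, z.1 x • gradient φ x := by
      rw [← integral_add
        (integrable_smul_of_Lp (Lp.memLp y.1) (hφ.memLp_gradient 2))
        (integrable_smul_of_Lp (Lp.memLp z.1) (hφ.memLp_gradient 2))]
      refine integral_congr_ae ?_
      filter_upwards [Lp.coeFn_add y.1 z.1] with x hx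
      rw [hx, Pi.add_apply, add_smul]
    have h2 : ∫ x in Ω, φ x • (y.2 + z.2 : LVector Ω e.q) x
        = (∫ x in Ω, φ x • y.2 x) + ∫ x in Ω, φ x • z.2 x := by
      rw [← integral_add
        (integrable_smul_of_Lp (hφ.memLp e.p) (Lp.memLp y.2))
        (integrable_smul_of_Lp (hφ.memLp e.p) (Lp.memLp z.2))]
      refine integral_congr_ae ?_
      filter_upwards [Lp.coeFn_add y.2 z.2] with x hx
      rw [hx, Pi.add_apply, smul_add]
    have hy' := hy φ hφ
    have hz' := hz φ hφ
    simp only [Prod.fst_add, Prod.snd_add]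
    rw [h1, h2, hy', hz', neg_add]
  smul_mem' := by
    intro c z hz φ hφ
    have h1 : ∫ x in Ω, (c • z.1 : LScalar Ω 2) x • gradient φ x
        = c • ∫ x in Ω, z.1 x • gradient φ x := by
      rw [← integral_smul]
      refine integral_congr_ae ?_
      filter_upwards [Lp.coeFn_smul c z.1] with x hx
      rw [hx, Pi.smul_apply, smul_eq_mul, mul_smul]
    have h2 : ∫ x in Ω, φ x • (c • z.2 : LVector Ω e.q) x = c • ∫ x in Ω, φ x • z.2 x := by
      rw [← integral_smul]
      refine integral_congr_ae ?_
      filter_upwards [Lp.coeFn_smul c z.2] with x hx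
      rw [hx, Pi.smul_apply, smul_comm]
    have hz' := hz φ hφ
    simp only [Prod.smul_fst, Prod.smul_snd]
    rw [h1, h2, hz', smul_neg]

/-- The elements of `GradSpace Ω e` with vanishing boundary values: the closure of `C_c^∞(Ω)`
for the norm `‖ψ‖_{L²} + ‖∇ψ‖_{L^{s*}}`. -/
def GradSpaceZero {d : ℕ} (Ω : Set (Space d)) (e : Exponents) :
    Submodule ℝ (GradSpace Ω e) :=
  (Submodule.span ℝ {z : LScalar Ω 2 × LVector Ω e.q | ∃ φ, IsTest Ω φ ∧
      z.1 =ᵐ[volume.restrict Ω] φ ∧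
      z.2 =ᵐ[volume.restrict Ω] gradient φ}).topologicalClosure.comap (GradSpace Ω e).subtype

/-- The space of boundary values (traces on `∂Ω`) of the functions `ψ ∈ L²(Ω)` with
`∇ψ ∈ (L^{s*}(Ω))ᵈ`: two such functions have the same boundary values when their difference is
in the closure of `C_c^∞(Ω)`. -/
abbrev TraceSpace {d : ℕ} (Ω : Set (Space d)) (e : Exponents) : Type :=
  GradSpace Ω e ⧸ GradSpaceZero Ω e

/-- For `v ∈ W(div; Ω)`, the linear form `ψ ↦ ∫_Ω ψ div v + ∫_Ω ∇ψ · v`. -/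
def greenForm {d : ℕ} {Ω : Set (Space d)} {e : Exponents} (v : Wdiv Ω e) :
    GradSpace Ω e →ₗ[ℝ] ℝ where
  toFun z := (∫ x in Ω, z.1.1 x * divOf v x) + ∫ x in Ω, inner ℝ (z.1.2 x) (fieldOf v x)
  map_add' y z := by
    have h1 : ∫ x in Ω, (y.1.1 + z.1.1 : LScalar Ω 2) x * divOf v x
        = (∫ x in Ω, y.1.1 x * divOf v x) + ∫ x in Ω, z.1.1 x * divOf v x := by
      rw [← integral_add
        (integrable_mul_of_Lp (Lp.memLp y.1.1) (Lp.memLp (divOf v)))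
        (integrable_mul_of_Lp (Lp.memLp z.1.1) (Lp.memLp (divOf v)))]
      refine integral_congr_ae ?_
      filter_upwards [Lp.coeFn_add y.1.1 z.1.1] with x hx
      rw [hx, Pi.add_apply, add_mul]
    have h2 : ∫ x in Ω, inner ℝ ((y.1.2 + z.1.2 : LVector Ω e.q) x) (fieldOf v x)
        = (∫ x in Ω, inner ℝ (y.1.2 x) (fieldOf v x))
          + ∫ x in Ω, inner ℝ (z.1.2 x) (fieldOf v x) := by
      rw [← integral_add
        (integrable_inner_of_Lp (Lp.memLp y.1.2) (Lp.memLp (fieldOf v)))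
        (integrable_inner_of_Lp (Lp.memLp z.1.2) (Lp.memLp (fieldOf v)))]
      refine integral_congr_ae ?_
      filter_upwards [Lp.coeFn_add y.1.2 z.1.2] with x hx
      rw [hx, Pi.add_apply, inner_add_left]
    simp only [Submodule.coe_add, Prod.fst_add, Prod.snd_add]
    rw [h1, h2]; ring
  map_smul' c z := by
    have h1 : ∫ x in Ω, (c • z.1.1 : LScalar Ω 2) x * divOf v x
        = c * ∫ x in Ω, z.1.1 x * divOf v x := by
      rw [← integral_const_mul]
      refine integral_congr_ae ?_
      filter_upwards [Lp.coeFn_smul c z.1.1] with x hx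
      rw [hx, Pi.smul_apply, smul_eq_mul, mul_assoc]
    have h2 : ∫ x in Ω, inner ℝ ((c • z.1.2 : LVector Ω e.q) x) (fieldOf v x)
        = c * ∫ x in Ω, inner ℝ (z.1.2 x) (fieldOf v x) := by
      rw [← integral_const_mul]
      refine integral_congr_ae ?_
      filter_upwards [Lp.coeFn_smul c z.1.2] with x hx
      rw [hx, Pi.smul_apply, real_inner_smul_left]
    simp only [Submodule.coe_smul, Prod.smul_fst, Prod.smul_snd, RingHom.id_apply, smul_eq_mul]
    rw [h1, h2]; ring

theorem gradSpaceZero_le_ker {d : ℕ} {Ω : Set (Space d)} {e : Exponents} (v : Wdiv Ω e) :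
    GradSpaceZero Ω e ≤ LinearMap.ker (greenForm v) := by
  let L : (LScalar Ω 2 × LVector Ω e.q) →L[ℝ] ℝ :=
    (((ContinuousLinearMap.mul ℝ ℝ).lpPairing (volume.restrict Ω) 2 2).flip (divOf v)).comp
        (ContinuousLinearMap.fst ℝ _ _)
      + (((innerSL ℝ (E := Space d)).lpPairing (volume.restrict Ω) e.q e.p).flip (fieldOf v)).comp
        (ContinuousLinearMap.snd ℝ _ _)
  have hL : ∀ z, L z = (∫ x in Ω, z.1 x * divOf v x) + ∫ x in Ω, inner ℝ (z.2 x) (fieldOf v x) := by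
    intro z
    simp only [L, add_apply, ContinuousLinearMap.comp_apply,
      ContinuousLinearMap.flip_apply, ContinuousLinearMap.lpPairing_eq_integral]
    rfl
  have hker : (Submodule.span ℝ {z : LScalar Ω 2 × LVector Ω e.q | ∃ φ, IsTest Ω φ ∧
      z.1 =ᵐ[volume.restrict Ω] φ ∧
      z.2 =ᵐ[volume.restrict Ω] gradient φ}).topologicalClosure
        ≤ LinearMap.ker (L : (LScalar Ω 2 × LVector Ω e.q) →ₗ[ℝ] ℝ) := by
    refine Submodule.topologicalClosure_minimal _ ?_ L.isClosed_ker
    refine Submodule.span_le.2 ?_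
    rintro z ⟨φ, hφ, h1, h2⟩
    have hv := v.2 φ hφ
    have e1 : ∫ x in Ω, z.1 x * divOf v x = ∫ x in Ω, v.1.2 x * φ x := by
      refine integral_congr_ae ?_
      filter_upwards [h1] with x hx
      rw [hx, mul_comm]; rfl
    have e2 : ∫ x in Ω, inner ℝ (z.2 x) (fieldOf v x)
        = ∫ x in Ω, inner ℝ (v.1.1 x) (gradient φ x) := by
      refine integral_congr_ae ?_
      filter_upwards [h2] with x hx
      rw [hx, real_inner_comm]; rfl
    change L z = 0
    rw [hL, e1, e2, hv]; ring
  intro z hz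
  have := hker hz
  change L z.1 = 0 at this
  rw [hL] at this
  exact this

/-- The generalized normal trace `v · ν` of `v ∈ W(div; Ω)` on `∂Ω`, as a linear form on boundary
values, given by Green's formula `⟨ψ, v · ν⟩ = ∫_Ω ψ div v + ∫_Ω ∇ψ · v`. -/
def normalTrace {d : ℕ} {Ω : Set (Space d)} {e : Exponents} (v : Wdiv Ω e) :
    TraceSpace Ω e →ₗ[ℝ] ℝ :=
  (GradSpaceZero Ω e).liftQ (greenForm v) (gradSpaceZero_le_ker v)

/-- `F(x, z) = ∑ i, a_i(x) z ^ α_i`. -/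
def F {d : ℕ} (e : Exponents) (a : Fin (e.N + 1) → Space d → ℝ) (x : Space d) (z : ℝ) : ℝ :=
  ∑ i, a i x * z ^ e.α i

/-- `(m, ρ)` solves one implicit Euler step of the mixed formulation, with time step `dt`,
porosity `φ`, coefficients `a`, source `f`, boundary datum `ρb` and previous density `ρprev`. -/
def IsMixedSolution {d : ℕ} {Ω : Set (Space d)} {e : Exponents} (dt : ℝ) (φ : Space d → ℝ)
    (a : Fin (e.N + 1) → Space d → ℝ) (f : LScalar Ω 2) (ρb : TraceSpace Ω e)
    (ρprev : LScalar Ω 2) (m : Wdiv Ω e) (ρ : LScalar Ω 2) : Prop :=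
  (∀ v : Wdiv Ω e,
    (∫ x in Ω, inner ℝ (F e a x ‖fieldOf m x‖ • fieldOf m x) (fieldOf v x))
      - (∫ x in Ω, ρ x * divOf v x) = -normalTrace v ρb) ∧
  (∀ q : LScalar Ω 2,
    (∫ x in Ω, φ x * ρ x / dt * q x) + (∫ x in Ω, divOf m x * q x)
      = (∫ x in Ω, f x * q x) + ∫ x in Ω, φ x * ρprev x / dt * q x)

end Forchheimer

end

/-! The mass balance determines the density pointwise: `ρ = ρprev + k (f - div m)` with `k = dt /
φ`. Substituting this, and writing the boundary datum as the class of some `ψ`, leaves an equation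
for `m` alone in W(div): `∫ F(|m|) m · v + ∫ k div m div v = -∫ ∇ψ · v + ∫ (ρprev + k f - ψ) div v`.
This is the Euler-Lagrange equation of a convex energy, the sum of the potential of `F`, the
quadratic term `k (div m)² / 2` and a linear term. Clarkson's inequality for the top power
(`potential_midpoint_le`) and the parallelogram identity for the divergence give a uniform convexity
gain of order `‖m‖ ^ s + ‖div m‖ ^ 2` at midpoints (`energy_midpoint_le`). Hence minimizing
sequences are Cauchy in the complete space W(div), so no weak compactness is needed, and the
minimizer is the only critical point (`existsUnique_critical_point`). Iterating the solution map
over the time steps gives the family. -/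

/-! ### Critical points of uniformly convex functionals -/

open Filter Topology in
/-- A functional with subgradients `A`, uniformly convex at midpoints with modulus `σ`, has exactly
one critical point. -/
theorem existsUnique_critical_point {E : Type*} [NormedAddCommGroup E] [NormedSpace ℝ E]
    [CompleteSpace E] (Φ : E → ℝ) (A : E → E →L[ℝ] ℝ) (σ : E → ℝ)
    (hgrad : ∀ a b, Φ b - Φ a ≤ A b (b - a))
    (hmid : ∀ a b, Φ ((1 / 2 : ℝ) • (a + b)) + σ (a - b) ≤ (Φ a + Φ b) / 2)
    (hσ : ∀ ε > 0, ∃ δ > 0, ∀ x, σ x < δ → ‖x‖ < ε)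
    (hcoer : ∀ C : ℝ, ∃ K, ∀ x, C * ‖x‖ ≤ σ x + K)
    (hemi : ∀ u v, Tendsto (fun t : ℝ => A (u + t • v) v) (𝓝[>] 0) (𝓝 (A u v))) :
    ∃! u, ∀ v, A u v = 0 := by
  -- Compare `a` with `0`: the tangent at `0` bounds `Φ (a / 2)` below by `Φ 0 - ‖A 0‖ ‖a‖ / 2`, and
  -- the midpoint gain `σ a` absorbs the linear loss by coercivity.
  have hbdd : BddBelow (Set.range Φ) := by
    obtain ⟨K, hK⟩ := hcoer ‖A 0‖
    refine ⟨Φ 0 - 2 * K, ?_⟩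
    rintro _ ⟨a, rfl⟩
    have h1 := hmid a 0
    have h2 := hgrad ((1 / 2 : ℝ) • (a + 0)) 0
    have h3 := hK a
    have h4 := (abs_le.1 ((A 0).le_opNorm a)).1
    simp only [add_zero, sub_zero, zero_sub, map_neg, map_smul, smul_eq_mul] at h1 h2
    have h5 : 0 ≤ ‖A 0‖ * ‖a‖ := by positivity
    linarith
  set I := sInf (Set.range Φ) with hI
  have hle : ∀ x, I ≤ Φ x := fun x => csInf_le hbdd ⟨x, rfl⟩
  have hseq : ∀ n : ℕ, ∃ u, Φ u < I + 1 / ((n : ℝ) + 1) := fun n => by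
    obtain ⟨_, ⟨u, rfl⟩, hu⟩ := exists_lt_of_csInf_lt (Set.range_nonempty Φ)
      (show sInf (Set.range Φ) < I + 1 / ((n : ℝ) + 1) by
        have : 0 < 1 / ((n : ℝ) + 1) := by positivity
        linarith)
    exact ⟨u, hu⟩
  choose u hu using hseq
  have hone : Tendsto (fun n : ℕ => 1 / ((n : ℝ) + 1)) atTop (𝓝 0) :=
    tendsto_one_div_add_atTop_nhds_zero_nat
  -- Midpoints cannot go below the infimum, so `σ (u m - u n)` is at most the mean of the two
  -- excesses over it.
  have hcau : CauchySeq u := by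
    refine Metric.cauchySeq_iff.2 fun ε hε => ?_
    obtain ⟨δ, hδ, H⟩ := hσ ε hε
    obtain ⟨N, hN⟩ := eventually_atTop.1 (hone.eventually (gt_mem_nhds hδ))
    refine ⟨N, fun m hm n hn => ?_⟩
    rw [dist_eq_norm]
    apply H
    linarith [hmid (u m) (u n), hle ((1 / 2 : ℝ) • (u m + u n)), hu m, hu n, hN m hm, hN n hn]
  obtain ⟨w, hw⟩ := cauchySeq_tendsto_of_complete hcau
  -- Continuity of `Φ` is not assumed. The tangent at the limit, a fixed continuous functional,
  -- provides lower semicontinuity along the sequence.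
  have hmin : ∀ x, Φ w ≤ Φ x := by
    intro x
    refine le_trans ?_ (hle x)
    have h1 : Tendsto (fun n : ℕ => I + 1 / ((n : ℝ) + 1) + A w (w - u n)) atTop
        (𝓝 (I + 0 + A w (w - w))) :=
      (tendsto_const_nhds.add hone).add
        (((A w).continuous.tendsto _).comp (tendsto_const_nhds.sub hw))
    simp only [add_zero, sub_self, map_zero] at h1
    exact ge_of_tendsto' h1 fun n => by linarith [hgrad (u n) w, hu n]
  -- The subgradient is taken at the displaced point: `0 ≤ Φ (w + t v) - Φ w ≤ t A (w + t v) v`.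
  -- Divide by `t` and let `t` decrease to `0`.
  have hpos : ∀ v, 0 ≤ A w v := by
    intro v
    refine ge_of_tendsto (hemi w v) ?_
    filter_upwards [self_mem_nhdsWithin] with t ht
    have h1 := hgrad w (w + t • v)
    rw [add_sub_cancel_left, map_smul, smul_eq_mul] at h1
    exact nonneg_of_mul_nonneg_right (le_trans (sub_nonneg.2 (hmin _)) h1) ht
  refine ⟨w, fun v => le_antisymm ?_ (hpos v), fun y hy => ?_⟩
  · have := hpos (-v)
    rw [map_neg] at this
    linarith
  -- A critical point is a minimizer, and two minimizers have `σ (y - w) ≤ 0` by the midpoint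
  -- inequality.
  · have hy' : Φ y ≤ Φ w := by
      have := hgrad w y
      rw [hy] at this
      linarith
    by_contra hne
    have h0 : 0 < ‖y - w‖ := norm_pos_iff.2 (sub_ne_zero.2 hne)
    obtain ⟨δ, hδ, H⟩ := hσ _ h0
    refine lt_irrefl _ (H (y - w) ?_)
    linarith [hmid y w, hmin ((1 / 2 : ℝ) • (y + w))]

/-! ### Convexity of powers of a Hilbert norm -/

theorem norm_rpow_mul_sq {H : Type*} [NormedAddCommGroup H] {α : ℝ} (hα : 0 ≤ α) (b : H) : ‖b‖ ^ α * ‖b‖ ^ 2 = ‖b‖ ^ (α + 2) := by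
  rw [Real.rpow_add' (norm_nonneg _) (by linarith)]
  norm_cast

section InnerProduct

variable {H : Type*} [NormedAddCommGroup H] [InnerProductSpace ℝ H]

/-- The function `‖b‖ ^ (α + 2) / (α + 2)` lies above its tangents, whose slopes are
`‖b‖ ^ α • b`. -/
theorem norm_rpow_sub_le_inner {α : ℝ} (hα : 0 ≤ α) (a b : H) :
    ‖b‖ ^ (α + 2) / (α + 2) - ‖a‖ ^ (α + 2) / (α + 2) ≤ ‖b‖ ^ α * inner ℝ b (b - a) := by
  have hp : (0 : ℝ) < α + 2 := by linarith
  have hc : (α + 2).HolderConjugate ((α + 2) / (α + 1)) := by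
    have := Real.HolderConjugate.conjExponent (p := α + 2) (by linarith)
    rwa [Real.conjExponent, show α + 2 - 1 = α + 1 by ring] at this
  -- After Cauchy-Schwarz the claim is Young's inequality for `‖a‖ * ‖b‖ ^ (α + 1)`.
  have hy := Real.young_inequality_of_nonneg (norm_nonneg a)
    (Real.rpow_nonneg (norm_nonneg b) (α + 1)) hc
  rw [← Real.rpow_mul (norm_nonneg b), mul_div_cancel₀ _ (by linarith : α + 1 ≠ 0)] at hy
  have h1 : ‖b‖ ^ α * (‖a‖ * ‖b‖) = ‖a‖ * ‖b‖ ^ (α + 1) := by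
    rw [Real.rpow_add' (norm_nonneg _) (by linarith), Real.rpow_one]; ring
  have h2 : inner ℝ b a ≤ ‖a‖ * ‖b‖ := by
    rw [mul_comm]; exact real_inner_le_norm b a
  have h3 := mul_le_mul_of_nonneg_left h2 (Real.rpow_nonneg (norm_nonneg b) α)
  rw [inner_sub_right, real_inner_self_eq_norm_sq, mul_sub, norm_rpow_mul_sq hα]
  have h4 : ‖b‖ ^ (α + 2) / ((α + 2) / (α + 1)) = ‖b‖ ^ (α + 2) - ‖b‖ ^ (α + 2) / (α + 2) := by
    field_simp; ring
  rw [h4] at hy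
  linarith

/-- Clarkson's inequality in a real inner product space. -/
theorem clarkson_inner {α : ℝ} (hα : 0 ≤ α) (a b : H) :
    ‖(1 / 2 : ℝ) • (a + b)‖ ^ (α + 2) + ‖(1 / 2 : ℝ) • (a - b)‖ ^ (α + 2)
      ≤ (‖a‖ ^ (α + 2) + ‖b‖ ^ (α + 2)) / 2 := by
  -- With `r = (α + 2) / 2 ≥ 1`, apply superadditivity of `t ^ r` to the squared norms, rewrite
  -- their sum by the parallelogram law, then use convexity of `t ^ r`.
  have hr : 1 ≤ (α + 2) / 2 := by linarith
  have key : ∀ c : H, ‖c‖ ^ (α + 2) = (‖c‖ ^ 2) ^ ((α + 2) / 2) := fun c => by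
    rw [← Real.rpow_natCast, ← Real.rpow_mul (norm_nonneg _)]
    congr 1; push_cast; ring
  have hpar : ‖(1 / 2 : ℝ) • (a + b)‖ ^ 2 + ‖(1 / 2 : ℝ) • (a - b)‖ ^ 2
      = (1 / 2) * ‖a‖ ^ 2 + (1 / 2) * ‖b‖ ^ 2 := by
    have := parallelogram_law_with_norm ℝ a b
    rw [norm_smul, norm_smul, Real.norm_of_nonneg (by norm_num)]
    nlinarith
  have h1 := Real.add_rpow_le_rpow_add (sq_nonneg ‖(1 / 2 : ℝ) • (a + b)‖)
    (sq_nonneg ‖(1 / 2 : ℝ) • (a - b)‖) hr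
  have h2 := (convexOn_rpow hr).2 (Set.mem_Ici.2 (sq_nonneg ‖a‖)) (Set.mem_Ici.2 (sq_nonneg ‖b‖))
    (by norm_num : (0 : ℝ) ≤ 1 / 2) (by norm_num : (0 : ℝ) ≤ 1 / 2) (by norm_num)
  simp only [smul_eq_mul] at h2
  rw [hpar] at h1
  rw [key, key, key a, key b]
  linarith

end InnerProduct

/-! ### Pointwise convexity and growth of the nonlinearity -/

noncomputable section

namespace Forchheimer

namespace Exponents

variable (e : Exponents)

theorem α_nonneg (i : Fin (e.N + 1)) : 0 ≤ e.α i := by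
  rw [← e.α_zero]
  exact e.strictMono.monotone (Fin.zero_le i)

theorem α_add_two_le_s (i : Fin (e.N + 1)) : e.α i + 2 ≤ e.s := by
  have := e.strictMono.monotone (Fin.le_last i)
  unfold s
  linarith

theorem p_toReal : e.p.toReal = e.s :=
  ENNReal.toReal_ofReal (by linarith [e.two_lt_s])

theorem p_ne_zero : e.p ≠ 0 := (zero_lt_one.trans_le (Fact.out : 1 ≤ e.p)).ne'

theorem p_ne_top : e.p ≠ ⊤ := ENNReal.ofReal_ne_top

end Exponents

/-- A lower power of a nonnegative number is controlled by a higher one. -/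
theorem rpow_le_one_add_rpow {z r t : ℝ} (hz : 0 ≤ z) (hr : 0 ≤ r) (hrt : r ≤ t) :
    z ^ r ≤ 1 + z ^ t := by
  rcases le_total z 1 with h | h
  · have := Real.rpow_le_one hz h hr
    have := Real.rpow_nonneg hz t
    linarith
  · have := Real.rpow_le_rpow_of_exponent_le h hrt
    linarith

/-- The primitive `∑ i, a_i(x) z ^ (α_i + 2) / (α_i + 2)` of `z ↦ F(x, z) z`. -/
def potential {d : ℕ} (e : Exponents) (a : Fin (e.N + 1) → Space d → ℝ) (x : Space d) (z : ℝ) :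
    ℝ :=
  ∑ i, a i x * (z ^ (e.α i + 2) / (e.α i + 2))

section Pointwise

variable {d : ℕ} {e : Exponents} {a : Fin (e.N + 1) → Space d → ℝ} {x : Space d}

theorem potential_sub_le_inner (ha : ∀ i, 0 ≤ a i x) (b c : Space d) :
    potential e a x ‖c‖ - potential e a x ‖b‖ ≤ inner ℝ (F e a x ‖c‖ • c) (c - b) := by
  rw [real_inner_smul_left, potential, potential, F, ← Finset.sum_sub_distrib, Finset.sum_mul]
  refine Finset.sum_le_sum fun i _ => ?_
  rw [← mul_sub, mul_assoc]
  exact mul_le_mul_of_nonneg_left (norm_rpow_sub_le_inner (e.α_nonneg i) b c) (ha i)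

/-- Clarkson's inequality holds for each power. All gains are nonnegative, and only the one of top
degree `s` is kept, since it controls the `Lˢ` norm. -/
theorem potential_midpoint_le (ha : ∀ i, 0 ≤ a i x) (b c : Space d) :
    potential e a x ‖(1 / 2 : ℝ) • (b + c)‖
        + a (Fin.last e.N) x / e.s * ‖(1 / 2 : ℝ) • (b - c)‖ ^ e.s
      ≤ (potential e a x ‖b‖ + potential e a x ‖c‖) / 2 := by
  have hs : ∀ i, 0 < e.α i + 2 := fun i => by linarith [e.α_nonneg i]
  have h1 : a (Fin.last e.N) x / e.s * ‖(1 / 2 : ℝ) • (b - c)‖ ^ e.s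
      ≤ ∑ i, a i x * (‖(1 / 2 : ℝ) • (b - c)‖ ^ (e.α i + 2) / (e.α i + 2)) := by
    refine le_trans (le_of_eq ?_) (Finset.single_le_sum (fun i _ => mul_nonneg (ha i)
      (div_nonneg (Real.rpow_nonneg (norm_nonneg _) _) (hs i).le))
      (Finset.mem_univ (Fin.last e.N)))
    rw [Exponents.s]
    ring
  refine (add_le_add_right h1 _).trans ?_
  rw [potential, potential, potential, ← Finset.sum_add_distrib, ← Finset.sum_add_distrib,
    Finset.sum_div]
  refine Finset.sum_le_sum fun i _ => ?_
  have h2 := mul_le_mul_of_nonneg_left (clarkson_inner (e.α_nonneg i) b c)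
    (div_nonneg (ha i) (hs i).le)
  refine le_of_eq_of_le ?_ (h2.trans_eq ?_) <;> ring

theorem potential_nonneg (ha : ∀ i, 0 ≤ a i x) {z : ℝ} (hz : 0 ≤ z) : 0 ≤ potential e a x z :=
  Finset.sum_nonneg fun i _ => mul_nonneg (ha i)
    (div_nonneg (Real.rpow_nonneg hz _) (by linarith [e.α_nonneg i]))

theorem potential_le {M : ℝ} (ha : ∀ i, 0 ≤ a i x ∧ a i x ≤ M) {z : ℝ} (hz : 0 ≤ z) :
    potential e a x z ≤ (e.N + 1) * M * (1 + z ^ e.s) := by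
  have h : ∀ i ∈ Finset.univ, a i x * (z ^ (e.α i + 2) / (e.α i + 2)) ≤ M * (1 + z ^ e.s) := by
    intro i _
    have h0 := e.α_nonneg i
    have h1 : z ^ (e.α i + 2) / (e.α i + 2) ≤ z ^ (e.α i + 2) :=
      div_le_self (Real.rpow_nonneg hz _) (by linarith)
    have h2 := rpow_le_one_add_rpow hz (by linarith) (e.α_add_two_le_s i)
    exact mul_le_mul (ha i).2 (h1.trans h2)
      (div_nonneg (Real.rpow_nonneg hz _) (by linarith)) ((ha i).1.trans (ha i).2)
  refine (Finset.sum_le_sum h).trans_eq ?_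
  simp [mul_assoc]

/-- All degrees `α_i + 1` are at most `s - 1`. This growth places the flux in the dual exponent and
supplies the dominating function for dominated convergence. -/
theorem norm_F_smul_le {M : ℝ} (ha : ∀ i, 0 ≤ a i x ∧ a i x ≤ M) (b : Space d) :
    ‖F e a x ‖b‖ • b‖ ≤ (e.N + 1) * M * (1 + ‖b‖ ^ (e.s - 1)) := by
  have h : ∀ i ∈ Finset.univ,
      a i x * ‖b‖ ^ e.α i * ‖b‖ ≤ M * (1 + ‖b‖ ^ (e.s - 1)) := by
    intro i _
    have h0 := e.α_nonneg i
    have h1 : ‖b‖ ^ e.α i * ‖b‖ = ‖b‖ ^ (e.α i + 1) := by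
      rw [Real.rpow_add' (norm_nonneg _) (by linarith), Real.rpow_one]
    rw [mul_assoc, h1]
    exact mul_le_mul (ha i).2 (rpow_le_one_add_rpow (norm_nonneg b) (by linarith)
      (by linarith [e.α_add_two_le_s i])) (Real.rpow_nonneg (norm_nonneg _) _)
      ((ha i).1.trans (ha i).2)
  have hF : 0 ≤ F e a x ‖b‖ :=
    Finset.sum_nonneg fun i _ => mul_nonneg (ha i).1 (Real.rpow_nonneg (norm_nonneg _) _)
  rw [norm_smul, Real.norm_of_nonneg hF, F, Finset.sum_mul]
  refine (Finset.sum_le_sum h).trans_eq ?_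
  simp [mul_assoc]

theorem continuous_F : Continuous (F e a x) :=
  continuous_finsetSum _ fun i _ =>
    continuous_const.mul (Real.continuous_rpow_const (e.α_nonneg i))

end Pointwise

/-! ### Integrability of the flux and of the potential -/

section Integrability

variable {d : ℕ} {Ω : Set (Space d)} {e : Exponents} {a : Fin (e.N + 1) → Space d → ℝ}

theorem aestronglyMeasurable_F_smul (ha : ∀ i, AEMeasurable (a i) (volume.restrict Ω))
    {m : Space d → Space d} (hm : AEStronglyMeasurable m (volume.restrict Ω)) :
    AEStronglyMeasurable (fun x => F e a x ‖m x‖ • m x) (volume.restrict Ω) := by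
  have h : AEMeasurable (fun x => F e a x ‖m x‖) (volume.restrict Ω) := Finset.aemeasurable_fun_sum _ fun i _ =>
    (ha i).mul ((Real.continuous_rpow_const (e.α_nonneg i)).measurable.comp_aemeasurable
      hm.norm.aemeasurable)
  exact h.aestronglyMeasurable.smul hm

theorem aestronglyMeasurable_potential (ha : ∀ i, AEMeasurable (a i) (volume.restrict Ω))
    {m : Space d → Space d} (hm : AEStronglyMeasurable m (volume.restrict Ω)) :
    AEStronglyMeasurable (fun x => potential e a x ‖m x‖) (volume.restrict Ω) := by
  refine AEMeasurable.aestronglyMeasurable ?_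
  unfold potential
  exact Finset.aemeasurable_fun_sum _ fun i _ =>
    (ha i).mul (((Real.continuous_rpow_const
      (by linarith [e.α_nonneg i])).measurable.comp_aemeasurable
      hm.norm.aemeasurable).div_const _)

theorem integrable_norm_rpow_s {m : Space d → Space d} (hm : MemLp m e.p (volume.restrict Ω)) :
    Integrable (fun x => ‖m x‖ ^ e.s) (volume.restrict Ω) := by
  have := hm.integrable_norm_rpow e.p_ne_zero e.p_ne_top
  rwa [e.p_toReal] at this

variable [IsFiniteMeasure (volume.restrict Ω)] {M : ℝ}

/-- Since `s* = s / (s - 1)`, the power `s - 1` maps `Lˢ` into `L^{s*}`; the constant is integrable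
because the measure is finite. -/
theorem memLp_one_add_rpow {m : Space d → ℝ} (hm : MemLp m e.p (volume.restrict Ω)) :
    MemLp (fun x => 1 + ‖m x‖ ^ (e.s - 1)) e.q (volume.restrict Ω) := by
  have hs := e.two_lt_s
  have hq : e.q = e.p / ENNReal.ofReal (e.s - 1) :=
    ENNReal.ofReal_div_of_pos (by linarith)
  have h := hm.norm_rpow_div (ENNReal.ofReal (e.s - 1))
  rw [ENNReal.toReal_ofReal (by linarith), ← hq] at h
  exact (memLp_const (1 : ℝ)).add h

theorem memLp_F_smul (ha_meas : ∀ i, AEMeasurable (a i) (volume.restrict Ω))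
    (ha : ∀ᵐ x ∂volume.restrict Ω, ∀ i, 0 ≤ a i x ∧ a i x ≤ M)
    {m : Space d → Space d} (hm : MemLp m e.p (volume.restrict Ω)) :
    MemLp (fun x => F e a x ‖m x‖ • m x) e.q (volume.restrict Ω) := by
  refine ((memLp_one_add_rpow hm.norm).const_mul ((e.N + 1) * M)).mono'
    (aestronglyMeasurable_F_smul ha_meas hm.1) ?_
  filter_upwards [ha] with x hx
  rw [norm_norm]
  exact norm_F_smul_le hx (m x)

theorem integrable_potential (ha_meas : ∀ i, AEMeasurable (a i) (volume.restrict Ω))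
    (ha : ∀ᵐ x ∂volume.restrict Ω, ∀ i, 0 ≤ a i x ∧ a i x ≤ M)
    {m : Space d → Space d} (hm : MemLp m e.p (volume.restrict Ω)) :
    Integrable (fun x => potential e a x ‖m x‖) (volume.restrict Ω) := by
  refine Integrable.mono' (((integrable_const (1 : ℝ)).add (integrable_norm_rpow_s hm)).const_mul
    ((e.N + 1) * M)) (aestronglyMeasurable_potential ha_meas hm.1) ?_
  filter_upwards [ha] with x hx
  rw [Real.norm_of_nonneg (potential_nonneg (fun i => (hx i).1) (norm_nonneg _))]
  exact potential_le hx (norm_nonneg _)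

end Integrability

/-! ### Duality pairing, completeness of W(div) and norm formulas -/

section Pairing

variable {d : ℕ} {Ω : Set (Space d)} {e : Exponents}

/-- The linear form `(v, w) ↦ ∫_Ω h · v + ∫_Ω g w` on `(Lˢ(Ω))ᵈ × L²(Ω)`. -/
def pairing (h : LVector Ω e.q) (g : LScalar Ω 2) : (LVector Ω e.p × LScalar Ω 2) →L[ℝ] ℝ :=
  ((innerSL ℝ (E := Space d)).lpPairing (volume.restrict Ω) e.q e.p h).comp
      (ContinuousLinearMap.fst ℝ _ _)
    + ((ContinuousLinearMap.mul ℝ ℝ).lpPairing (volume.restrict Ω) 2 2 g).comp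
      (ContinuousLinearMap.snd ℝ _ _)

theorem pairing_apply (h : LVector Ω e.q) (g : LScalar Ω 2) (z : LVector Ω e.p × LScalar Ω 2) :
    pairing h g z = (∫ x in Ω, inner ℝ (h x) (z.1 x)) + ∫ x in Ω, g x * z.2 x := by
  simp only [pairing, add_apply, ContinuousLinearMap.comp_apply,
    ContinuousLinearMap.lpPairing_eq_integral]
  rfl

theorem pairing_toLp_apply {h : Space d → Space d} {g : Space d → ℝ}
    (hh : MemLp h e.q (volume.restrict Ω)) (hg : MemLp g 2 (volume.restrict Ω))
    (z : LVector Ω e.p × LScalar Ω 2) :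
    pairing (hh.toLp h) (hg.toLp g) z
      = (∫ x in Ω, inner ℝ (h x) (z.1 x)) + ∫ x in Ω, g x * z.2 x := by
  rw [pairing_apply]
  congr 1
  · refine integral_congr_ae ?_
    filter_upwards [hh.coeFn_toLp] with x hx
    rw [hx]
  · refine integral_congr_ae ?_
    filter_upwards [hg.coeFn_toLp] with x hx
    rw [hx]

/-- Each test function imposes one continuous linear equation on `(v, div v)`, so the space is an
intersection of closed kernels. -/
theorem isClosed_Wdiv : IsClosed (Wdiv Ω e : Set (LVector Ω e.p × LScalar Ω 2)) := by
  have h : (Wdiv Ω e : Set (LVector Ω e.p × LScalar Ω 2))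
      = ⋂ (φ : Space d → ℝ) (hφ : IsTest Ω φ), {z | pairing (e := e)
        ((hφ.memLp_gradient e.q).toLp _) ((hφ.memLp 2).toLp _) z = 0} := by
    ext z
    simp only [Set.mem_iInter, Set.mem_ofPred_eq, pairing_toLp_apply]
    refine forall₂_congr fun φ hφ => ?_
    simp only [real_inner_comm, mul_comm (φ _)]
    exact eq_neg_iff_add_eq_zero
  rw [h]
  exact isClosed_iInter fun φ => isClosed_iInter fun hφ =>
    isClosed_eq (ContinuousLinearMap.continuous _) continuous_const

instance : CompleteSpace (Wdiv Ω e) := isClosed_Wdiv.completeSpace_coe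

end Pairing

theorem norm_LVector_rpow {d : ℕ} {Ω : Set (Space d)} {e : Exponents} (m : LVector Ω e.p) :
    ‖m‖ ^ e.s = ∫ x in Ω, ‖m x‖ ^ e.s := by
  have hs := e.two_lt_s
  have h0 : 0 ≤ ∫ x in Ω, ‖m x‖ ^ e.s :=
    integral_nonneg fun x => Real.rpow_nonneg (norm_nonneg _) _
  rw [Lp.norm_def, (Lp.memLp m).eLpNorm_eq_integral_rpow_norm e.p_ne_zero e.p_ne_top, e.p_toReal,
    ENNReal.toReal_ofReal (Real.rpow_nonneg h0 _), ← Real.rpow_mul h0,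
    inv_mul_cancel₀ (by linarith), Real.rpow_one]

theorem norm_LScalar_sq {d : ℕ} {Ω : Set (Space d)} (w : LScalar Ω 2) :
    ‖w‖ ^ 2 = ∫ x in Ω, w x ^ 2 := by
  rw [← real_inner_self_eq_norm_sq, L2.inner_def]
  simp [pow_two]

/-! ### The convexity modulus controls the product norm -/

section Modulus

variable {X Y : Type*} [SeminormedAddCommGroup X] [SeminormedAddCommGroup Y] {c c' s : ℝ}

theorem norm_lt_of_modulus_lt (hc : 0 < c) (hc' : 0 < c') (hs : 0 < s) {ε : ℝ} (hε : 0 < ε) :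
    ∃ δ > 0, ∀ z : X × Y, c * ‖z.1‖ ^ s + c' * ‖z.2‖ ^ 2 < δ → ‖z‖ < ε := by
  refine ⟨min (c * ε ^ s) (c' * ε ^ 2), by positivity, fun z hz => ?_⟩
  have h1 : 0 ≤ c * ‖z.1‖ ^ s := by positivity
  have h2 : 0 ≤ c' * ‖z.2‖ ^ 2 := by positivity
  rw [Prod.norm_def, max_lt_iff]
  constructor
  · have : c * ‖z.1‖ ^ s < c * ε ^ s := by linarith [hz.trans_le (min_le_left _ _)]
    exact (Real.rpow_lt_rpow_iff (norm_nonneg _) hε.le hs).1 (lt_of_mul_lt_mul_left this hc.le)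
  · have : c' * ‖z.2‖ ^ 2 < c' * ε ^ 2 := by linarith [hz.trans_le (min_le_right _ _)]
    exact lt_of_pow_lt_pow_left₀ 2 hε.le (lt_of_mul_lt_mul_left this hc'.le)

theorem mul_le_mul_sq_add {c : ℝ} (hc : 0 < c) (C y : ℝ) : C * y ≤ c * y ^ 2 + C ^ 2 / (4 * c) := by
  have h : c * y ^ 2 + C ^ 2 / (4 * c) - C * y = (2 * c * y - C) ^ 2 / (4 * c) := by
    field_simp; ring
  have : 0 ≤ (2 * c * y - C) ^ 2 / (4 * c) := by positivity
  linarith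

/-- The product norm is a maximum, so one component has to be estimated. Completing the square
handles exponent `2`, and `t ^ 2 ≤ 1 + t ^ s` reduces the first component to it. -/
theorem mul_norm_le_modulus_add (hc : 0 < c) (hc' : 0 < c') (hs : 2 ≤ s) (C : ℝ) :
    ∃ K, ∀ z : X × Y, C * ‖z‖ ≤ c * ‖z.1‖ ^ s + c' * ‖z.2‖ ^ 2 + K := by
  refine ⟨C ^ 2 / (4 * c) + c + C ^ 2 / (4 * c'), fun z => ?_⟩
  have h1 : 0 ≤ c * ‖z.1‖ ^ s := by positivity
  have h2 : 0 ≤ c' * ‖z.2‖ ^ 2 := by positivity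
  have h3 : 0 ≤ C ^ 2 / (4 * c) := by positivity
  have h4 : 0 ≤ C ^ 2 / (4 * c') := by positivity
  rcases max_choice ‖z.1‖ ‖z.2‖ with h | h <;> rw [Prod.norm_def, h]
  · have h5 := mul_le_mul_sq_add hc C ‖z.1‖
    have h6 := rpow_le_one_add_rpow (norm_nonneg z.1) zero_le_two hs
    rw [Real.rpow_two] at h6
    linarith [mul_le_mul_of_nonneg_left h6 hc.le]
  · linarith [mul_le_mul_sq_add hc' C ‖z.2‖]

end Modulus

/-! ### The energy and the reduced problem -/

theorem memLp_mul_of_ae_le {X : Type*} [MeasurableSpace X] {μ : Measure X} {r : ℝ≥0∞}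
    {k w : X → ℝ} {C : ℝ} (hk_meas : AEMeasurable k μ) (hk : ∀ᵐ x ∂μ, 0 ≤ k x ∧ k x ≤ C)
    (hw : MemLp w r μ) : MemLp (fun x => k x * w x) r μ := by
  refine (hw.norm.const_mul C).mono' (hk_meas.aestronglyMeasurable.mul hw.1) ?_
  filter_upwards [hk] with x hx
  rw [norm_mul, Real.norm_of_nonneg hx.1]
  exact mul_le_mul_of_nonneg_right hx.2 (norm_nonneg _)

/-- Admissible coefficients of the reduced problem: the `a_i` of `F`, and a weight `k`
for the divergence. -/
structure IsAdmissible {d : ℕ} (Ω : Set (Space d)) (e : Exponents)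
    (a : Fin (e.N + 1) → Space d → ℝ) (k : Space d → ℝ) (aLow aUp kLow kUp : ℝ) : Prop where
  measurable_a : ∀ i, AEMeasurable (a i) (volume.restrict Ω)
  measurable_k : AEMeasurable k (volume.restrict Ω)
  aLow_pos : 0 < aLow
  kLow_pos : 0 < kLow
  bound_a : ∀ᵐ x ∂volume.restrict Ω, ∀ i, 0 ≤ a i x ∧ a i x ≤ aUp
  bound_last : ∀ᵐ x ∂volume.restrict Ω, aLow ≤ a (Fin.last e.N) x
  bound_k : ∀ᵐ x ∂volume.restrict Ω, kLow ≤ k x ∧ k x ≤ kUp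

namespace IsAdmissible

variable {d : ℕ} {Ω : Set (Space d)} {e : Exponents} {a : Fin (e.N + 1) → Space d → ℝ}
  {k : Space d → ℝ} {aLow aUp kLow kUp : ℝ}

theorem memLp_mul (H : IsAdmissible Ω e a k aLow aUp kLow kUp)
    {w : Space d → ℝ} (hw : MemLp w 2 (volume.restrict Ω)) :
    MemLp (fun x => k x * w x) 2 (volume.restrict Ω) :=
  memLp_mul_of_ae_le H.measurable_k (C := kUp)
    (H.bound_k.mono fun _ hx => ⟨H.kLow_pos.le.trans hx.1, hx.2⟩) hw

theorem integrable_half_mul_sq (H : IsAdmissible Ω e a k aLow aUp kLow kUp)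
    {w : Space d → ℝ} (hw : MemLp w 2 (volume.restrict Ω)) :
    Integrable (fun x => k x / 2 * w x ^ 2) (volume.restrict Ω) := by
  refine ((integrable_mul_of_Lp (H.memLp_mul hw) hw).div_const 2).congr (.of_forall fun x => ?_)
  simp only
  ring

end IsAdmissible

/-- The energy `∫_Ω (G(x, |v|) + k w² / 2) - ∫_Ω h · v - ∫_Ω g w`, where `G` is the potential. -/
def energy {d : ℕ} {Ω : Set (Space d)} {e : Exponents} (a : Fin (e.N + 1) → Space d → ℝ)
    (k : Space d → ℝ) (h : LVector Ω e.q) (g : LScalar Ω 2) (z : LVector Ω e.p × LScalar Ω 2) : ℝ :=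
  (∫ x in Ω, (potential e a x ‖z.1 x‖ + k x / 2 * z.2 x ^ 2)) - pairing h g z

namespace IsAdmissible

variable {d : ℕ} {Ω : Set (Space d)} {e : Exponents} {a : Fin (e.N + 1) → Space d → ℝ}
  {k : Space d → ℝ} {aLow aUp kLow kUp : ℝ} [IsFiniteMeasure (volume.restrict Ω)]

theorem integrable_density (H : IsAdmissible Ω e a k aLow aUp kLow kUp)
    (z : LVector Ω e.p × LScalar Ω 2) :
    Integrable (fun x => potential e a x ‖z.1 x‖ + k x / 2 * z.2 x ^ 2) (volume.restrict Ω) :=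
  (integrable_potential H.measurable_a H.bound_a (Lp.memLp z.1)).add
    (H.integrable_half_mul_sq (Lp.memLp z.2))

/-- The derivative of the energy at `z`. -/
def derivEnergy (H : IsAdmissible Ω e a k aLow aUp kLow kUp) (h : LVector Ω e.q) (g : LScalar Ω 2)
    (z : LVector Ω e.p × LScalar Ω 2) : (LVector Ω e.p × LScalar Ω 2) →L[ℝ] ℝ :=
  pairing ((memLp_F_smul H.measurable_a H.bound_a (Lp.memLp z.1)).toLp _)
    ((H.memLp_mul (Lp.memLp z.2)).toLp _) - pairing h g

theorem derivEnergy_apply (H : IsAdmissible Ω e a k aLow aUp kLow kUp) (h : LVector Ω e.q)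
    (g : LScalar Ω 2) (z y : LVector Ω e.p × LScalar Ω 2) :
    H.derivEnergy h g z y = (∫ x in Ω, inner ℝ (F e a x ‖z.1 x‖ • z.1 x) (y.1 x))
      + (∫ x in Ω, k x * z.2 x * y.2 x) - pairing h g y := by
  rw [derivEnergy, sub_apply, pairing_toLp_apply]

theorem energy_sub_le (H : IsAdmissible Ω e a k aLow aUp kLow kUp) (h : LVector Ω e.q)
    (g : LScalar Ω 2) (y z : LVector Ω e.p × LScalar Ω 2) :
    energy a k h g z - energy a k h g y ≤ H.derivEnergy h g z (z - y) := by
  have h1 : (∫ x in Ω, (potential e a x ‖z.1 x‖ + k x / 2 * z.2 x ^ 2))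
        - (∫ x in Ω, (potential e a x ‖y.1 x‖ + k x / 2 * y.2 x ^ 2))
      ≤ (∫ x in Ω, inner ℝ (F e a x ‖z.1 x‖ • z.1 x) ((z - y).1 x))
        + ∫ x in Ω, k x * z.2 x * (z - y).2 x := by
    have i1 := integrable_inner_of_Lp (memLp_F_smul H.measurable_a H.bound_a (Lp.memLp z.1))
      (Lp.memLp (z - y).1)
    have i2 := integrable_mul_of_Lp (H.memLp_mul (Lp.memLp z.2)) (Lp.memLp (z - y).2)
    rw [← integral_sub (H.integrable_density z) (H.integrable_density y), ← integral_add i1 i2]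
    refine integral_mono_ae ((H.integrable_density z).sub (H.integrable_density y)) (i1.add i2) ?_
    filter_upwards [H.bound_a, H.bound_k, Lp.coeFn_sub z.1 y.1, Lp.coeFn_sub z.2 y.2]
      with x ha hk e1 e2
    rw [Prod.fst_sub, Prod.snd_sub, e1, e2, Pi.sub_apply, Pi.sub_apply]
    have hG := potential_sub_le_inner (fun i => (ha i).1) (y.1 x) (z.1 x)
    have hk0 : 0 ≤ k x := H.kLow_pos.le.trans hk.1
    -- The quadratic part lies above its tangent with remainder `k (z - y)² / 2`.
    nlinarith [mul_nonneg hk0 (sq_nonneg (z.2 x - y.2 x))]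
  rw [derivEnergy_apply, energy, energy, map_sub]
  linarith

/-- The linear part cancels. The factor `(1 / 2) ^ s` comes from the half difference in Clarkson's
inequality; `1 / 8` comes from `(y² + z²) / 2 - ((y + z) / 2)² = (y - z)² / 4` times `k / 2`. -/
theorem energy_midpoint_le (H : IsAdmissible Ω e a k aLow aUp kLow kUp) (h : LVector Ω e.q)
    (g : LScalar Ω 2) (y z : LVector Ω e.p × LScalar Ω 2) :
    energy a k h g ((1 / 2 : ℝ) • (y + z))
        + (aLow / e.s * (1 / 2) ^ e.s * ‖(y - z).1‖ ^ e.s + kLow / 8 * ‖(y - z).2‖ ^ 2)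
      ≤ (energy a k h g y + energy a k h g z) / 2 := by
  have hs : 0 < e.s := by linarith [e.two_lt_s]
  have i1 := (integrable_norm_rpow_s (Lp.memLp (y - z).1)).const_mul (aLow / e.s * (1 / 2) ^ e.s)
  have i2 := (Lp.memLp (y - z).2).integrable_sq.const_mul (kLow / 8)
  have i3 := H.integrable_density ((1 / 2 : ℝ) • (y + z))
  have i4 : Integrable (fun x => aLow / e.s * (1 / 2) ^ e.s * ‖(y - z).1 x‖ ^ e.s
      + kLow / 8 * (y - z).2 x ^ 2) (volume.restrict Ω) := i1.add i2
  have h1 : (∫ x in Ω, (potential e a x ‖((1 / 2 : ℝ) • (y + z)).1 x‖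
          + k x / 2 * ((1 / 2 : ℝ) • (y + z)).2 x ^ 2))
        + ((∫ x in Ω, aLow / e.s * (1 / 2) ^ e.s * ‖(y - z).1 x‖ ^ e.s)
          + ∫ x in Ω, kLow / 8 * (y - z).2 x ^ 2)
      ≤ ((∫ x in Ω, (potential e a x ‖y.1 x‖ + k x / 2 * y.2 x ^ 2))
        + (∫ x in Ω, (potential e a x ‖z.1 x‖ + k x / 2 * z.2 x ^ 2))) / 2 := by
    rw [← integral_add i1 i2, ← integral_add i3 i4,
      ← integral_add (H.integrable_density y) (H.integrable_density z), ← integral_div]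
    refine integral_mono_ae (i3.add i4)
      (((H.integrable_density y).add (H.integrable_density z)).div_const 2) ?_
    filter_upwards [H.bound_a, H.bound_last, H.bound_k, Lp.coeFn_sub y.1 z.1,
      Lp.coeFn_sub y.2 z.2, Lp.coeFn_add y.1 z.1, Lp.coeFn_add y.2 z.2,
      Lp.coeFn_smul (1 / 2 : ℝ) (y.1 + z.1), Lp.coeFn_smul (1 / 2 : ℝ) (y.2 + z.2)]
      with x ha hl hk e1 e2 e3 e4 e5 e6
    simp only [Prod.fst_sub, Prod.snd_sub, Prod.smul_fst, Prod.smul_snd, Prod.fst_add,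
      Prod.snd_add]
    rw [e1, e2, e5, e6, Pi.smul_apply, Pi.smul_apply, e3, e4]
    simp only [Pi.sub_apply, Pi.add_apply, smul_eq_mul]
    have hG := potential_midpoint_le (fun i => (ha i).1) (y.1 x) (z.1 x)
    have hn : ‖(1 / 2 : ℝ) • (y.1 x - z.1 x)‖ ^ e.s
        = (1 / 2) ^ e.s * ‖y.1 x - z.1 x‖ ^ e.s := by
      rw [norm_smul, Real.norm_of_nonneg (by norm_num),
        Real.mul_rpow (by norm_num) (norm_nonneg _)]
    have hq : aLow / e.s * (1 / 2) ^ e.s * ‖y.1 x - z.1 x‖ ^ e.s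
        ≤ a (Fin.last e.N) x / e.s * ‖(1 / 2 : ℝ) • (y.1 x - z.1 x)‖ ^ e.s := by
      rw [hn, mul_assoc]
      gcongr
    nlinarith [mul_le_mul_of_nonneg_right hk.1 (sq_nonneg (y.2 x - z.2 x))]
  rw [integral_const_mul, integral_const_mul, ← norm_LVector_rpow, ← norm_LScalar_sq] at h1
  rw [energy, energy, energy, map_smul, map_add, smul_eq_mul]
  linarith

-- The divergence term is affine in `t`. The flux term converges by dominated convergence: for `0 <
-- t < 1` the norm of `z + t y` is at most `|z| + |y|`, which gives a bound independent of `t`.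
open Filter Topology in
theorem tendsto_derivEnergy (H : IsAdmissible Ω e a k aLow aUp kLow kUp) (h : LVector Ω e.q)
    (g : LScalar Ω 2) (z y : LVector Ω e.p × LScalar Ω 2) :
    Tendsto (fun t : ℝ => H.derivEnergy h g (z + t • y) y) (𝓝[>] 0)
      (𝓝 (H.derivEnergy h g z y)) := by
  have hadd : ∀ t : ℝ, ∀ᵐ x ∂volume.restrict Ω, (z + t • y).1 x = z.1 x + t • y.1 x := fun t => by
    filter_upwards [Lp.coeFn_add z.1 (t • y.1), Lp.coeFn_smul t y.1] with x e1 e2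
    rw [Prod.fst_add, Prod.smul_fst, e1, Pi.add_apply, e2, Pi.smul_apply]
  have hadd' : ∀ t : ℝ, ∀ᵐ x ∂volume.restrict Ω, (z + t • y).2 x = z.2 x + t * y.2 x := fun t => by
    filter_upwards [Lp.coeFn_add z.2 (t • y.2), Lp.coeFn_smul t y.2] with x e1 e2
    rw [Prod.snd_add, Prod.smul_snd, e1, Pi.add_apply, e2, Pi.smul_apply, smul_eq_mul]
  have hfield : ∀ t : ℝ, ∫ x in Ω, inner ℝ (F e a x ‖(z + t • y).1 x‖ • (z + t • y).1 x) (y.1 x)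
      = ∫ x in Ω, inner ℝ (F e a x ‖z.1 x + t • y.1 x‖ • (z.1 x + t • y.1 x)) (y.1 x) := fun t => by
    refine integral_congr_ae ?_
    filter_upwards [hadd t] with x hx
    rw [hx]
  have hdiv : ∀ t : ℝ, ∫ x in Ω, k x * (z + t • y).2 x * y.2 x
      = (∫ x in Ω, k x * z.2 x * y.2 x) + t * ∫ x in Ω, k x * y.2 x * y.2 x := fun t => by
    rw [← integral_const_mul, ← integral_add
      (integrable_mul_of_Lp (H.memLp_mul (Lp.memLp z.2)) (Lp.memLp y.2))
      ((integrable_mul_of_Lp (H.memLp_mul (Lp.memLp y.2)) (Lp.memLp y.2)).const_mul t)]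
    refine integral_congr_ae ?_
    filter_upwards [hadd' t] with x hx
    rw [hx]
    ring
  simp only [derivEnergy_apply, hfield, hdiv]
  refine Tendsto.sub_const (Tendsto.add ?_ ?_) _
  · have hb : MemLp (fun x => ‖z.1 x‖ + ‖y.1 x‖) e.p (volume.restrict Ω) :=
      (Lp.memLp z.1).norm.add (Lp.memLp y.1).norm
    have hbound := integrable_mul_of_Lp ((memLp_one_add_rpow hb).const_mul ((e.N + 1) * aUp))
      (Lp.memLp y.1).norm
    refine tendsto_integral_filter_of_dominated_convergence _ (.of_forall fun t =>
      (aestronglyMeasurable_F_smul H.measurable_a ((Lp.aestronglyMeasurable z.1).add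
        ((Lp.aestronglyMeasurable y.1).const_smul t))).inner (Lp.aestronglyMeasurable y.1))
        ?_ hbound (.of_forall fun x => ?_)
    · filter_upwards [Ioo_mem_nhdsGT (zero_lt_one (α := ℝ))] with t ht
      filter_upwards [H.bound_a] with x ha
      refine (norm_inner_le_norm _ _).trans (mul_le_mul_of_nonneg_right ?_ (norm_nonneg _))
      refine (norm_F_smul_le ha _).trans (mul_le_mul_of_nonneg_left ?_ ?_)
      · refine add_le_add_right (Real.rpow_le_rpow (norm_nonneg _) ?_
          (by linarith [e.two_lt_s])) 1
        rw [Real.norm_of_nonneg (by positivity : 0 ≤ ‖z.1 x‖ + ‖y.1 x‖)]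
        refine (norm_add_le _ _).trans (add_le_add_right ?_ _)
        rw [norm_smul, Real.norm_of_nonneg ht.1.le]
        exact mul_le_of_le_one_left (norm_nonneg _) ht.2.le
      · exact mul_nonneg (by positivity) ((ha 0).1.trans (ha 0).2)
    · have hcont : Continuous fun b : Space d => inner ℝ (F e a x ‖b‖ • b) (y.1 x) :=
        ((continuous_F.comp continuous_norm).smul continuous_id).inner continuous_const
      have hline : Tendsto (fun t : ℝ => z.1 x + t • y.1 x) (𝓝[>] 0) (𝓝 (z.1 x)) := by
        refine tendsto_nhdsWithin_of_tendsto_nhds ?_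
        have : Continuous fun t : ℝ => z.1 x + t • y.1 x := by fun_prop
        simpa using this.tendsto 0
      exact (hcont.tendsto _).comp hline
  · refine tendsto_nhdsWithin_of_tendsto_nhds ?_
    have : Continuous fun t : ℝ =>
        (∫ x in Ω, k x * z.2 x * y.2 x) + t * ∫ x in Ω, k x * y.2 x * y.2 x := by fun_prop
    simpa using this.tendsto 0

/-- The reduced problem, in which the density has been eliminated, is uniquely solvable on
`W(div; Ω)`. -/
theorem existsUnique_reduced (H : IsAdmissible Ω e a k aLow aUp kLow kUp) (h : LVector Ω e.q)
    (g : LScalar Ω 2) :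
    ∃! u : Wdiv Ω e, ∀ v : Wdiv Ω e,
      (∫ x in Ω, inner ℝ (F e a x ‖fieldOf u x‖ • fieldOf u x) (fieldOf v x))
        + (∫ x in Ω, k x * divOf u x * divOf v x)
      = (∫ x in Ω, inner ℝ (h x) (fieldOf v x)) + ∫ x in Ω, g x * divOf v x := by
  have hs := e.two_lt_s
  have hc : 0 < aLow / e.s * (1 / 2) ^ e.s :=
    mul_pos (div_pos H.aLow_pos (by linarith)) (by positivity)
  have hc' : 0 < kLow / 8 := by linarith [H.kLow_pos]
  -- The estimates hold on all of `Lˢ × L²` and are inherited by W(div). Restricting there makes the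
  -- critical point equation tested by W(div) only.
  have key := existsUnique_critical_point (E := Wdiv Ω e) (fun u => energy a k h g u)
    (fun u => (H.derivEnergy h g u).comp (Wdiv Ω e).subtypeL)
    (fun u => aLow / e.s * (1 / 2) ^ e.s * ‖u.1.1‖ ^ e.s + kLow / 8 * ‖u.1.2‖ ^ 2)
    (fun u v => H.energy_sub_le h g u v) (fun u v => H.energy_midpoint_le h g u v)
    (fun ε hε => by
      obtain ⟨δ, hδ, hz⟩ := norm_lt_of_modulus_lt (X := LVector Ω e.p) (Y := LScalar Ω 2)
        hc hc' (by linarith : 0 < e.s) hε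
      exact ⟨δ, hδ, fun u => hz u.1⟩)
    (fun C => by
      obtain ⟨K, hK⟩ := mul_norm_le_modulus_add (X := LVector Ω e.p) (Y := LScalar Ω 2)
        hc hc' hs.le C
      exact ⟨K, fun u => hK u.1⟩)
    (fun u v => H.tendsto_derivEnergy h g u v)
  refine (existsUnique_congr fun u => forall_congr' fun v => ?_).1 key
  change H.derivEnergy h g u v = 0 ↔ _
  rw [derivEnergy_apply, pairing_apply, sub_eq_zero]
  rfl

end IsAdmissible

/-! ### Elimination of the density and time stepping -/

section Step

variable {d : ℕ} {Ω : Set (Space d)} {e : Exponents} {a : Fin (e.N + 1) → Space d → ℝ}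
  {φ : Space d → ℝ} {φLow φUp dt : ℝ}

/-- The mass balance, tested against `L²(Ω)`, holds pointwise. -/
theorem massBalance_iff (hφ_meas : AEMeasurable φ (volume.restrict Ω)) (hφLow : 0 < φLow)
    (hφ : ∀ᵐ x ∂volume.restrict Ω, φLow ≤ φ x ∧ φ x ≤ φUp) (hdt : 0 < dt)
    (f ρ ρprev w : LScalar Ω 2) :
    (∀ q : LScalar Ω 2, (∫ x in Ω, φ x * ρ x / dt * q x) + (∫ x in Ω, w x * q x)
        = (∫ x in Ω, f x * q x) + ∫ x in Ω, φ x * ρprev x / dt * q x) ↔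
      ∀ᵐ x ∂volume.restrict Ω, ρ x = ρprev x + dt / φ x * f x - dt / φ x * w x := by
  have hmem : ∀ r : LScalar Ω 2, MemLp (fun x => φ x * r x / dt) 2 (volume.restrict Ω) := fun r => by
    simp only [div_eq_inv_mul]
    exact (memLp_mul_of_ae_le hφ_meas (hφ.mono fun _ hx => ⟨hφLow.le.trans hx.1, hx.2⟩)
      (Lp.memLp r)).const_mul dt⁻¹
  have hpt : ∀ᵐ x ∂volume.restrict Ω, ρ x = ρprev x + dt / φ x * f x - dt / φ x * w x ↔
      φ x * ρ x / dt + w x - (f x + φ x * ρprev x / dt) = 0 := by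
    filter_upwards [hφ] with x hx
    have h0 : φ x ≠ 0 := (hφLow.trans_le hx.1).ne'
    constructor
    · intro h
      rw [h]
      field_simp
      ring
    · intro h
      field_simp at h ⊢
      linarith
  have hint : ∀ q : LScalar Ω 2,
      (∫ x in Ω, (φ x * ρ x / dt + w x - (f x + φ x * ρprev x / dt)) * q x)
        = ((∫ x in Ω, φ x * ρ x / dt * q x) + ∫ x in Ω, w x * q x)
          - ((∫ x in Ω, f x * q x) + ∫ x in Ω, φ x * ρprev x / dt * q x) := fun q => by
    have i1 := integrable_mul_of_Lp (hmem ρ) (Lp.memLp q)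
    have i2 := integrable_mul_of_Lp (Lp.memLp w) (Lp.memLp q)
    have i3 := integrable_mul_of_Lp (Lp.memLp f) (Lp.memLp q)
    have i4 := integrable_mul_of_Lp (hmem ρprev) (Lp.memLp q)
    rw [← integral_add i1 i2, ← integral_add i3 i4]
    refine Eq.trans (integral_congr_ae (.of_forall fun x => ?_))
      (integral_sub (i1.add i2) (i3.add i4))
    simp only
    ring
  constructor
  · intro h
    have hr : MemLp (fun x => φ x * ρ x / dt + w x - (f x + φ x * ρprev x / dt)) 2
        (volume.restrict Ω) :=
      ((hmem ρ).add (Lp.memLp w)).sub ((Lp.memLp f).add (hmem ρprev))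
    -- The residual lies in `L²` and is itself an admissible test function.
    have h0 : ∫ x in Ω, (φ x * ρ x / dt + w x - (f x + φ x * ρprev x / dt)) ^ 2 = 0 := by
      have h1 := hint (hr.toLp _)
      rw [h, sub_self] at h1
      rw [← h1]
      refine integral_congr_ae ?_
      filter_upwards [hr.coeFn_toLp] with x hx
      rw [hx, pow_two]
    rw [integral_eq_zero_iff_of_nonneg (fun x => sq_nonneg _) hr.integrable_sq] at h0
    filter_upwards [hpt, h0] with x h1 h2
    exact h1.2 (pow_eq_zero_iff two_ne_zero |>.1 h2)
  · intro h q
    rw [← sub_eq_zero, ← hint]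
    refine integral_eq_zero_of_ae ?_
    filter_upwards [hpt, h] with x h1 h2
    rw [h1.1 h2, zero_mul, Pi.zero_apply]

/-- A mixed solution is the same as a solution `m` of the reduced problem with weight `dt / φ`
together with the density recovered from `m`. -/
theorem existsUnique_isMixedSolution [IsFiniteMeasure (volume.restrict Ω)] {aLow aUp : ℝ}
    (ha_meas : ∀ i, AEMeasurable (a i) (volume.restrict Ω)) (haLow : 0 < aLow)
    (ha_last : ∀ᵐ x ∂volume.restrict Ω, aLow ≤ a (Fin.last e.N) x)
    (ha : ∀ᵐ x ∂volume.restrict Ω, ∀ i, 0 ≤ a i x ∧ a i x ≤ aUp)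
    (hφ_meas : AEMeasurable φ (volume.restrict Ω)) (hφLow : 0 < φLow)
    (hφ : ∀ᵐ x ∂volume.restrict Ω, φLow ≤ φ x ∧ φ x ≤ φUp) (hdt : 0 < dt)
    (f : LScalar Ω 2) (ρb : TraceSpace Ω e) (ρprev : LScalar Ω 2) :
    ∃! z : Wdiv Ω e × LScalar Ω 2, IsMixedSolution dt φ a f ρb ρprev z.1 z.2 := by
  -- Positivity of `φUp` does not follow from an almost everywhere bound when `Ω` is null; the
  -- maximum is positive in any case.
  have hUp : 0 < max φLow φUp := lt_max_of_lt_left hφLow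
  have H : IsAdmissible Ω e a (fun x => dt / φ x) aLow aUp (dt / max φLow φUp) (dt / φLow) :=
    { measurable_a := ha_meas
      measurable_k := hφ_meas.const_div dt
      aLow_pos := haLow
      kLow_pos := by positivity
      bound_a := ha
      bound_last := ha_last
      bound_k := hφ.mono fun x hx =>
        ⟨div_le_div_of_nonneg_left hdt.le (hφLow.trans_le hx.1) (hx.2.trans (le_max_right _ _)),
          div_le_div_of_nonneg_left hdt.le hφLow hx.1⟩ }
  -- With a representative `ψ` fixed, the normal trace unfolds to Green's formula and splits into
  -- the data `-∇ψ` and `-ψ` of the reduced problem.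
  obtain ⟨ψ, rfl⟩ := Submodule.mkQ_surjective _ ρb
  let kf : LScalar Ω 2 := (H.memLp_mul (Lp.memLp f)).toLp _
  let R : Wdiv Ω e → LScalar Ω 2 := fun m =>
    ρprev + kf - (H.memLp_mul (Lp.memLp (divOf m))).toLp _
  have hR : ∀ m, ∀ᵐ x ∂volume.restrict Ω,
      R m x = ρprev x + dt / φ x * f x - dt / φ x * divOf m x := fun m => by
    filter_upwards [Lp.coeFn_sub (ρprev + kf) ((H.memLp_mul (Lp.memLp (divOf m))).toLp _),
      Lp.coeFn_add ρprev kf, (H.memLp_mul (Lp.memLp f)).coeFn_toLp,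
      (H.memLp_mul (Lp.memLp (divOf m))).coeFn_toLp] with x e1 e2 e3 e4
    rw [e1, Pi.sub_apply, e2, Pi.add_apply, e3, e4]
  have hiff : ∀ m ρ, IsMixedSolution dt φ a f ((GradSpaceZero Ω e).mkQ ψ) ρprev m ρ ↔
      (∀ v : Wdiv Ω e,
        (∫ x in Ω, inner ℝ (F e a x ‖fieldOf m x‖ • fieldOf m x) (fieldOf v x))
          + (∫ x in Ω, dt / φ x * divOf m x * divOf v x)
        = (∫ x in Ω, inner ℝ ((-ψ.1.2) x) (fieldOf v x))
          + ∫ x in Ω, (ρprev + kf - ψ.1.1) x * divOf v x) ∧ ρ = R m := by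
    intro m ρ
    have hρ : (∀ᵐ x ∂volume.restrict Ω,
        ρ x = ρprev x + dt / φ x * f x - dt / φ x * divOf m x) ↔ ρ = R m := by
      refine ⟨fun h => Lp.ext ?_, ?_⟩
      · filter_upwards [h, hR m] with x h1 h2
        rw [h1, h2]
      · rintro rfl
        exact hR m
    rw [IsMixedSolution, massBalance_iff hφ_meas hφLow hφ hdt, hρ]
    refine and_congr_left fun h => forall_congr' fun v => ?_
    subst h
    have j0 := integrable_mul_of_Lp (Lp.memLp (ρprev + kf)) (Lp.memLp (divOf v))
    have j1 := integrable_mul_of_Lp (H.memLp_mul (Lp.memLp (divOf m))) (Lp.memLp (divOf v))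
    have j2 := integrable_mul_of_Lp (Lp.memLp ψ.1.1) (Lp.memLp (divOf v))
    have h1 : ∫ x in Ω, R m x * divOf v x = (∫ x in Ω, (ρprev + kf) x * divOf v x)
        - ∫ x in Ω, dt / φ x * divOf m x * divOf v x := by
      rw [← integral_sub j0 j1]
      refine integral_congr_ae ?_
      filter_upwards [Lp.coeFn_sub (ρprev + kf) ((H.memLp_mul (Lp.memLp (divOf m))).toLp _),
        (H.memLp_mul (Lp.memLp (divOf m))).coeFn_toLp] with x e1 e2
      rw [e1, Pi.sub_apply, e2, sub_mul]
    have h2 : ∫ x in Ω, (ρprev + kf - ψ.1.1) x * divOf v x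
        = (∫ x in Ω, (ρprev + kf) x * divOf v x) - ∫ x in Ω, ψ.1.1 x * divOf v x := by
      rw [← integral_sub j0 j2]
      refine integral_congr_ae ?_
      filter_upwards [Lp.coeFn_sub (ρprev + kf) ψ.1.1] with x e1
      rw [e1, Pi.sub_apply, sub_mul]
    have h3 : ∫ x in Ω, inner ℝ ((-ψ.1.2) x) (fieldOf v x)
        = -∫ x in Ω, inner ℝ (ψ.1.2 x) (fieldOf v x) := by
      rw [← integral_neg]
      refine integral_congr_ae ?_
      filter_upwards [Lp.coeFn_neg ψ.1.2] with x e1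
      rw [e1, Pi.neg_apply, inner_neg_left]
    have h4 : normalTrace v ((GradSpaceZero Ω e).mkQ ψ)
        = (∫ x in Ω, ψ.1.1 x * divOf v x) + ∫ x in Ω, inner ℝ (ψ.1.2 x) (fieldOf v x) := rfl
    rw [h1, h2, h3, h4]
    constructor <;> intro h <;> linarith
  obtain ⟨u, hu, huniq⟩ := H.existsUnique_reduced (-ψ.1.2) (ρprev + kf - ψ.1.1)
  refine ⟨(u, R u), (hiff u (R u)).2 ⟨hu, rfl⟩, ?_⟩
  rintro ⟨m, ρ⟩ hz
  obtain ⟨h1, rfl⟩ := (hiff m ρ).1 hz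
  rw [huniq m h1]

end Step

/-- A time-stepping scheme all of whose steps are uniquely solvable is uniquely solvable. -/
theorem existsUnique_timeStepping {X Y : Type*} {J : ℕ} (P : Fin J → Y → X → Y → Prop)
    (h : ∀ j y, ∃! z : X × Y, P j y z.1 z.2) (y₀ : Y) :
    ∃! z : (Fin J → X) × (Fin (J + 1) → Y),
      z.2 0 = y₀ ∧ ∀ j : Fin J, P j (z.2 j.castSucc) (z.1 j) (z.2 j.succ) := by
  choose S hS huniq using h
  let Z : Fin (J + 1) → Y := fun i => Fin.induction (motive := fun _ => Y) y₀
    (fun j y => (S j y).2) i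
  have hZ : ∀ j : Fin J, Z j.succ = (S j (Z j.castSucc)).2 := fun j => Fin.induction_succ ..
  refine ⟨(fun j => (S j (Z j.castSucc)).1, Z), ⟨rfl, fun j => ?_⟩, ?_⟩
  · simp only [hZ]
    exact hS j (Z j.castSucc)
  · rintro ⟨x, y⟩ ⟨h0, hP⟩
    have hstep : ∀ j : Fin J, (x j, y j.succ) = S j (y j.castSucc) := fun j =>
      huniq j _ (x j, y j.succ) (hP j)
    -- Induction forces the densities first; the fields are then read off from the solution map.
    have hy : y = Z := by
      funext i
      induction i using Fin.induction with
      | zero => exact h0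
      | succ j ih => rw [hZ, ← ih, ← hstep]
    subst hy
    refine Prod.ext (funext fun j => ?_) rfl
    simp only [← hstep]

end Forchheimer

end

open Forchheimer in
theorem theorem3p1 {d : ℕ} (hd : 2 ≤ d) (Ω : Set (Space d)) (hΩ : IsOpen Ω)
    (hΩb : Bornology.IsBounded Ω) (e : Exponents)
    (T : ℝ) (hT : 0 < T) (J : ℕ) (hJ : 0 < J)
    (a : Fin J → Fin (e.N + 1) → Space d → ℝ)
    (ha_meas : ∀ j i, AEMeasurable (a j i) (volume.restrict Ω))
    (aLow aUp : ℝ) (haLow : 0 < aLow)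
    (ha_zero : ∀ j, ∀ᵐ x ∂volume.restrict Ω, aLow < a j 0 x ∧ a j 0 x < aUp)
    (ha_last : ∀ j, ∀ᵐ x ∂volume.restrict Ω,
      aLow < a j (Fin.last e.N) x ∧ a j (Fin.last e.N) x < aUp)
    (ha : ∀ j i, ∀ᵐ x ∂volume.restrict Ω, 0 ≤ a j i x ∧ a j i x ≤ aUp)
    (φ : Space d → ℝ) (hφ_meas : AEMeasurable φ (volume.restrict Ω))
    (φLow φUp : ℝ) (hφLow : 0 < φLow)
    (hφ : ∀ᵐ x ∂volume.restrict Ω, φLow ≤ φ x ∧ φ x ≤ φUp)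
    (f : Fin J → LScalar Ω 2) (ρb : Fin J → TraceSpace Ω e) (ρ₀ : LScalar Ω 2) :
    (∀ (j : Fin J) (ρprev : LScalar Ω 2), ∃! z : Wdiv Ω e × LScalar Ω 2,
      IsMixedSolution (T / J) φ (a j) (f j) (ρb j) ρprev z.1 z.2) ∧
    (∃! z : (Fin J → Wdiv Ω e) × (Fin (J + 1) → LScalar Ω 2),
      z.2 0 = ρ₀ ∧ ∀ j : Fin J,
        IsMixedSolution (T / J) φ (a j) (f j) (ρb j) (z.2 j.castSucc) (z.1 j) (z.2 j.succ)) := by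
  -- Boundedness of `Ω` enters through the finiteness of its measure.
  have : IsFiniteMeasure (volume.restrict Ω) :=
    ⟨by rw [Measure.restrict_apply_univ]; exact hΩb.measure_lt_top⟩
  have hdt : 0 < T / J := div_pos hT (Nat.cast_pos.2 hJ)
  have hstep : ∀ (j : Fin J) (ρprev : LScalar Ω 2), ∃! z : Wdiv Ω e × LScalar Ω 2,
      IsMixedSolution (T / J) φ (a j) (f j) (ρb j) ρprev z.1 z.2 := fun j ρprev =>
    existsUnique_isMixedSolution (ha_meas j) haLow ((ha_last j).mono fun _ hx => hx.1.le)
      (ae_all_iff.2 (ha j)) hφ_meas hφLow hφ hdt (f j) (ρb j) ρprev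
  exact ⟨hstep, existsUnique_timeStepping
    (fun j y m ρ => IsMixedSolution (T / J) φ (a j) (f j) (ρb j) y m ρ) hstep ρ₀⟩
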